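/- Let $n,d,w$ be integers with $2\le d\le w\le n/2$. Let $A(n,2d,w)$ be the maximum number of codewords in a binary code of length $n$ all of whose codewords have Hamming weight $w$ and whose distinct codewords are at Hamming distance at least $2d$. Let $\mathbb F_2(n,w)$ be the set of binary vectors of length $n$ and weight $w$ (so $|\mathbb F_2(n,w)|=\binom nw$), and let $$V(n,r,w)=\sum_{i=0}^{r}\binom wi\binom{n-w}{i}$$ be the volume of a sphere of radius $r$ in the Johnson metric on $\mathbb F_2(n,w)$. For positive integers $i,j,k\le w$ with $k\le i+j$ define $$p^k_{i,j}=\sum_{l=a}^{b}\binom{n-w-k}{l}\binom{k}{i-l}\binom{k}{j-l}\binom{w-k}{i+j-k-l},$$ $$a=\max\{0,\,i-k,\,j-k,\,i+j-w\},\qquad b=\min\{i,\,j,\,i+j-k,\,n-w-k\},$$ and put $p^k_{i,j}=0$ for $k>i+j$. For $1\le r\le w$ let $$e(n,r,w)=\frac16\sum_{i=1}^{r}\sum_{j=1}^{r}\sum_{k=1}^{r}\binom wk\binom{n-w}{k}\,p^k_{i,j}.$$ Then $$A(n,2d,w)\ \ge\ \frac{|\mathbb F_2(n,w)|}{V(n,d-1,w)}\cdot\frac{\log_2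 V(n,d-1,w)-\log_2\sqrt{e(n,d-1,w)}}{10}.$$ -/

import Mathlib

/-- `F₂(n, w)`: the set of binary vectors of length `n` and Hamming weight `w`. -/
def constWeightVectors (n w : ℕ) : Finset (Fin n → ZMod 2) :=
  Finset.univ.filter fun x => hammingNorm x = w

/-- `C` is a binary code of length `n`, constant weight `w`, in which distinct codewords
have Hamming distance at least `δ`. -/
def IsConstWeightCode (n δ w : ℕ) (C : Finset (Fin n → ZMod 2)) : Prop :=
  C ⊆ constWeightVectors n w ∧ ∀ x ∈ C, ∀ y ∈ C, x ≠ y → δ ≤ hammingDist x y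

instance (n δ w : ℕ) : DecidablePred (IsConstWeightCode n δ w) := fun C => by
  unfold IsConstWeightCode
  infer_instance

/-- `A(n, δ, w)`: the maximum number of codewords in a binary code of length `n`, constant
weight `w` and minimum Hamming distance (at least) `δ`. The empty code qualifies, so this is a
maximum over a nonempty finite family. -/
def maxConstWeightCode (n δ w : ℕ) : ℕ :=
  (Finset.univ.filter (IsConstWeightCode n δ w)).sup Finset.card

/-- `V(n, r, w)`: the volume of a sphere of radius `r` in the Johnson metric (half the Hamming
distance) on the binary vectors of length `n` and weight `w`. -/
def johnsonVolume (n r w : ℕ) : ℕ :=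
  ∑ i ∈ Finset.range (r + 1), w.choose i * (n - w).choose i

/-- The number `p^k_{i,j}` (for fixed `n`, `w` with `2 * w ≤ n`, and `i, j, k ≤ w`). The
truncated subtractions in the lower summation limit agree with the integer ones because `0` is
one of the terms of the maximum; all the others are genuine, by `k ≤ w ≤ n - w`, `k ≤ i + j`
and the upper summation limit. -/
def johnsonIntersection (n w i j k : ℕ) : ℕ :=
  if k ≤ i + j then
    ∑ l ∈ Finset.Icc
        (max 0 (max (i - k) (max (j - k) (i + j - w))))
        (min i (min j (min (i + j - k) (n - w - k)))),
      (n - w - k).choose l * k.choose (i - l) * k.choose (j - l) *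
        (w - k).choose (i + j - k - l)
  else 0

/-- The quantity `e(n, r, w)`. -/
noncomputable def johnsonE (n r w : ℕ) : ℝ :=
  (1 / 6 : ℝ) * ∑ i ∈ Finset.Icc 1 r, ∑ j ∈ Finset.Icc 1 r, ∑ k ∈ Finset.Icc 1 r,
    (w.choose k : ℝ) * ((n - w).choose k : ℝ) * (johnsonIntersection n w i j k : ℝ)

/-!
Constant weight codes of distance `2d` are independent sets of the graph joining `w`-sets at Johnson
distance at most `d - 1`. Choose an independent set of this graph at random from the hard-core model
at fugacity `c = 1 / (4 √e)`. Conditionally on its trace away from the closed neighbourhood of a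
vertex `v`, it is hard-core on `v` and the neighbours left unblocked. Every neighbourhood spans only
`3e` edges, so many unblocked neighbours force a large expected number of chosen ones, while few of
them give a small partition function and hence a large probability that `v` itself is chosen.
Averaging over `v` gains the factor `log (V / √e)` over the greedy bound.

The edges spanned by a neighbourhood are counted by the intersection numbers of the Johnson scheme:
given `X` and `Y` at distance `k`, sort the sets `Z` at distances `i` from `X` and `j` from `Y` by
`l = #(Z \ (X ∪ Y))`; the traces of `Z` on the four Venn regions of `X` and `Y` are then arbitrary
subsets of prescribed sizes, whence the four binomials.
-/

open Finset

section HardCore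

variable {V : Type*} (G : SimpleGraph V) [DecidableRel G.Adj]

/-- The vertices of `W` not adjacent to any vertex of `J`: those a random independent set of trace
`J` off `W` may still contain. -/
def unblocked (W J : Finset V) : Finset V :=
  {u ∈ W | ∀ y ∈ J, ¬ G.Adj u y}

theorem unblocked_subset (W J : Finset V) : unblocked G W J ⊆ W :=
  filter_subset _ _

variable {G} in
theorem mem_unblocked {W J : Finset V} {u : V} :
    u ∈ unblocked G W J ↔ u ∈ W ∧ ∀ y ∈ J, ¬ G.Adj u y :=
  mem_filter

variable [DecidableEq V]

/-- The independent sets of `G` contained in `A`. -/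
def indepSubsets (A : Finset V) : Finset (Finset V) :=
  {S ∈ A.powerset | G.IsIndepSet (S : Set V)}

/-- The unnormalised expectation of `f` under the hard-core model with fugacity `c` on the
subgraph induced by `A`. -/
def hardCoreSum (c : ℝ) (A : Finset V) (f : Finset V → ℝ) : ℝ :=
  ∑ S ∈ indepSubsets G A, c ^ #S * f S

/-- The partition function of the hard-core model with fugacity `c` on the subgraph induced
by `A`. -/
def hardCorePartition (c : ℝ) (A : Finset V) : ℝ :=
  ∑ S ∈ indepSubsets G A, c ^ #S

variable {G} {c : ℝ} {A : Finset V} {f g : Finset V → ℝ}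

theorem mem_indepSubsets {S : Finset V} :
    S ∈ indepSubsets G A ↔ S ⊆ A ∧ ∀ x ∈ S, ∀ y ∈ S, ¬ G.Adj x y := by
  simp only [indepSubsets, mem_filter, mem_powerset, and_congr_right_iff]
  exact fun _ => ⟨fun h x hx y hy hxy => h hx hy hxy.ne hxy, fun h x hx y hy _ => h x hx y hy⟩

theorem hardCorePartition_pos (hc : 0 < c) : 0 < hardCorePartition G c A :=
  sum_pos (fun _ _ => pow_pos hc _) ⟨∅, by simp [mem_indepSubsets]⟩

theorem hardCorePartition_le_one_add_pow (hc : 0 ≤ c) :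
    hardCorePartition G c A ≤ (1 + c) ^ #A := by
  have hbinom := sum_pow_mul_eq_add_pow c 1 A
  simp only [one_pow, mul_one] at hbinom
  rw [add_comm, ← hbinom]
  exact sum_le_sum_of_subset_of_nonneg (filter_subset _ _) fun _ _ _ => pow_nonneg hc _

theorem hardCorePartition_le_exp (hc : 0 ≤ c) :
    hardCorePartition G c A ≤ Real.exp (c * #A) := by
  calc hardCorePartition G c A ≤ (1 + c) ^ #A := hardCorePartition_le_one_add_pow hc
    _ ≤ Real.exp c ^ #A := by gcongr; linarith [Real.add_one_le_exp c]
    _ = Real.exp (c * #A) := by rw [← Real.exp_nat_mul, mul_comm]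

theorem hardCoreSum_const (a : ℝ) :
    hardCoreSum G c A (fun _ => a) = a * hardCorePartition G c A := by
  rw [hardCoreSum, hardCorePartition, ← sum_mul, mul_comm]

theorem hardCoreSum_add :
    hardCoreSum G c A (fun S => f S + g S) = hardCoreSum G c A f + hardCoreSum G c A g := by
  simp only [hardCoreSum, mul_add, sum_add_distrib]

theorem hardCoreSum_sub :
    hardCoreSum G c A (fun S => f S - g S) = hardCoreSum G c A f - hardCoreSum G c A g := by
  simp only [hardCoreSum, mul_sub, sum_sub_distrib]

theorem hardCoreSum_const_mul (a : ℝ) :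
    hardCoreSum G c A (fun S => a * f S) = a * hardCoreSum G c A f := by
  simp only [hardCoreSum, mul_sum, mul_left_comm]

theorem hardCoreSum_sum {ι : Type*} (s : Finset ι) (F : ι → Finset V → ℝ) :
    hardCoreSum G c A (fun S => ∑ i ∈ s, F i S) = ∑ i ∈ s, hardCoreSum G c A (F i) := by
  simp only [hardCoreSum, mul_sum]
  exact sum_comm

theorem hardCoreSum_congr (h : ∀ S ∈ indepSubsets G A, f S = g S) :
    hardCoreSum G c A f = hardCoreSum G c A g :=
  sum_congr rfl fun S hS => by rw [h S hS]

theorem hardCoreSum_mono (hc : 0 ≤ c) (h : ∀ S ∈ indepSubsets G A, f S ≤ g S) :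
    hardCoreSum G c A f ≤ hardCoreSum G c A g :=
  sum_le_sum fun S hS => mul_le_mul_of_nonneg_left (h S hS) (pow_nonneg hc _)

theorem hardCoreSum_nonneg (hc : 0 ≤ c) (h : ∀ S ∈ indepSubsets G A, 0 ≤ f S) :
    0 ≤ hardCoreSum G c A f :=
  sum_nonneg fun S hS => mul_nonneg (pow_nonneg hc _) (h S hS)

/-- The spatial Markov property: given its trace `J` off `W`, the random independent set is inside
`W` again hard-core, on the vertices of `W` not blocked by `J`. -/
theorem hardCoreSum_eq_hardCoreSum_sdiff {W : Finset V} (hW : W ⊆ A) :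
    hardCoreSum G c A f = hardCoreSum G c (A \ W) fun J =>
      hardCoreSum G c (unblocked G W J) fun I => f (J ∪ I) := by
  simp only [hardCoreSum, mul_sum]
  rw [sum_sigma']
  refine sum_nbij' (fun S => ⟨S \ W, S ∩ W⟩) (fun p => p.1 ∪ p.2) ?_ ?_ ?_ ?_ ?_
  · intro S hS
    simp only [mem_sigma, mem_indepSubsets, subset_iff, mem_unblocked] at hS ⊢
    grind
  · rintro ⟨J, I⟩ hJI
    simp only [mem_sigma, mem_indepSubsets, subset_iff, mem_unblocked] at hJI ⊢
    grind [G.adj_comm]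
  · intro S _
    exact sdiff_union_inter S W
  · rintro ⟨J, I⟩ hJI
    simp only [mem_sigma, mem_indepSubsets, subset_iff, mem_unblocked, mem_sdiff] at hJI
    have hJ : (J ∪ I) \ W = J := by grind
    have hI : (J ∪ I) ∩ W = I := by grind
    simp only [hJ, hI]
  · intro S _
    rw [← mul_assoc, ← pow_add, card_sdiff_add_card_inter, sdiff_union_inter]

theorem hardCoreSum_empty : hardCoreSum G c ∅ f = f ∅ := by
  have hempty : indepSubsets G ∅ = {∅} := by
    ext S
    simp +contextual [mem_indepSubsets, subset_empty]
  simp [hardCoreSum, hempty]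

theorem hardCoreSum_insert_of_forall_adj {v : V} {U : Finset V} (hU : ∀ u ∈ U, G.Adj v u) :
    hardCoreSum G c (insert v U) f = c * f {v} + hardCoreSum G c U f := by
  have hins : indepSubsets G (insert v U) = insert {v} (indepSubsets G U) := by
    ext S
    simp only [mem_insert, mem_indepSubsets]
    grind [G.irrefl]
  have hnot : {v} ∉ indepSubsets G U := fun h =>
    G.irrefl (hU v ((mem_indepSubsets.1 h).1 (mem_singleton_self v)))
  rw [hardCoreSum, hins, sum_insert hnot, card_singleton, pow_one, hardCoreSum]

theorem hardCoreSum_mem (hc : 0 ≤ c) {u : V} (hu : u ∈ A) :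
    hardCoreSum G c A (fun S => if u ∈ S then 1 else 0) =
      c / (1 + c) * hardCoreSum G c A fun S => if ∀ x ∈ S, ¬ G.Adj u x then 1 else 0 := by
  rw [← hardCoreSum_const_mul, hardCoreSum_eq_hardCoreSum_sdiff (singleton_subset_iff.2 hu),
    hardCoreSum_eq_hardCoreSum_sdiff (singleton_subset_iff.2 hu)]
  refine hardCoreSum_congr fun J hJ => ?_
  have huJ : u ∉ J := fun h => by simpa using (mem_indepSubsets.1 hJ).1 h
  by_cases hfree : ∀ y ∈ J, ¬ G.Adj u y
  · have hunblocked : unblocked G {u} J = insert u ∅ := by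
      rw [unblocked, filter_singleton, if_pos hfree, insert_empty]
    rw [hunblocked, hardCoreSum_insert_of_forall_adj (by simp),
      hardCoreSum_insert_of_forall_adj (by simp), hardCoreSum_empty, hardCoreSum_empty]
    have hfree' : ∀ x ∈ J ∪ {u}, ¬ G.Adj u x := by grind [G.irrefl]
    simp only [union_empty, if_pos hfree, if_pos hfree', if_neg huJ, mem_union, mem_singleton,
      or_true, if_true]
    field_simp
    ring
  · have hblocked : unblocked G {u} J = ∅ := by
      rw [unblocked, filter_singleton, if_neg hfree]
    rw [hblocked, hardCoreSum_empty, hardCoreSum_empty, union_empty, if_neg hfree, if_neg huJ,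
      mul_zero]

theorem hardCoreSum_mem_le (hc : 0 ≤ c) {u : V} (hu : u ∈ A) :
    hardCoreSum G c A (fun S => if u ∈ S then 1 else 0) ≤
      c / (1 + c) * hardCorePartition G c A := by
  rw [hardCoreSum_mem hc hu, ← one_mul (hardCorePartition G c A), ← hardCoreSum_const]
  gcongr
  exact hardCoreSum_mono hc fun S _ => by split_ifs <;> norm_num

theorem le_hardCoreSum_mem (hc : 0 ≤ c) {u : V} (hu : u ∈ A) :
    c / (1 + c) * (1 - c / (1 + c) * #{y ∈ A | G.Adj u y}) * hardCorePartition G c A ≤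
      hardCoreSum G c A fun S => if u ∈ S then 1 else 0 := by
  have hunion : hardCorePartition G c A ≤
      hardCoreSum G c A (fun S => if ∀ x ∈ S, ¬ G.Adj u x then 1 else 0) +
        ∑ y ∈ A with G.Adj u y, hardCoreSum G c A fun S => if y ∈ S then 1 else 0 := by
    rw [← one_mul (hardCorePartition G c A), ← hardCoreSum_const, ← hardCoreSum_sum,
      ← hardCoreSum_add]
    refine hardCoreSum_mono hc fun S hS => ?_
    have hindicator : ∀ y ∈ ({y ∈ A | G.Adj u y} : Finset V), (0 : ℝ) ≤ if y ∈ S then 1 else 0 :=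
      fun y _ => by split_ifs <;> norm_num
    by_cases hblock : ∀ x ∈ S, ¬ G.Adj u x
    · rw [if_pos hblock]
      exact le_add_of_nonneg_right (sum_nonneg hindicator)
    · push Not at hblock
      obtain ⟨y, hyS, huy⟩ := hblock
      rw [if_neg (by grind), zero_add]
      simpa [hyS] using single_le_sum hindicator
        (mem_filter.2 ⟨(mem_indepSubsets.1 hS).1 hyS, huy⟩)
  have hneighbors : ∑ y ∈ A with G.Adj u y, hardCoreSum G c A (fun S => if y ∈ S then 1 else 0) ≤
      #{y ∈ A | G.Adj u y} * (c / (1 + c) * hardCorePartition G c A) := by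
    rw [← nsmul_eq_mul]
    exact sum_le_card_nsmul _ _ _ fun y hy => hardCoreSum_mem_le hc (mem_filter.1 hy).1
  rw [hardCoreSum_mem hc hu, mul_assoc]
  gcongr
  linarith

theorem le_hardCoreSum_card (hc : 0 ≤ c) :
    c / (1 + c) * (#A - c / (1 + c) * #(G.interedges A A)) * hardCorePartition G c A ≤
      hardCoreSum G c A fun S => #S := by
  have hcard : hardCoreSum G c A (fun S => (#S : ℝ)) =
      ∑ u ∈ A, hardCoreSum G c A fun S => if u ∈ S then 1 else 0 := by
    rw [← hardCoreSum_sum]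
    refine hardCoreSum_congr fun S hS => ?_
    rw [sum_boole, filter_mem_eq_inter, inter_eq_right.2 (mem_indepSubsets.1 hS).1]
  have hdeg : (#(G.interedges A A) : ℝ) = ∑ u ∈ A, (#{y ∈ A | G.Adj u y} : ℝ) := by
    rw [SimpleGraph.interedges_def]
    simp only [card_filter, sum_product]
    push_cast
    rfl
  rw [hcard]
  refine le_trans (le_of_eq ?_) (sum_le_sum fun u hu => le_hardCoreSum_mem hc hu)
  rw [← sum_mul, ← mul_sum, sum_sub_distrib, ← mul_sum, hdeg]
  simp

end HardCore

section LocalOccupancy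

variable {V : Type*} [Fintype V] [DecidableEq V] {G : SimpleGraph V} [DecidableRel G.Adj]

/-- Conditionally on the trace of the random independent set off the closed neighbourhood of `v`,
the set is hard-core on `v` together with the unblocked part `U` of the neighbourhood; the
hypothesis is the claim for that conditional model. -/
theorem hardCoreSum_local_occupancy_nonneg {c a m : ℝ} (hc : 0 ≤ c) {v : V}
    (hloc : ∀ U ⊆ G.neighborFinset v,
      m * (c + hardCorePartition G c U) ≤ a * c + hardCoreSum G c U fun I => #I) :
    0 ≤ hardCoreSum G c univ fun S =>
      (if v ∈ S then a else 0) + #(S ∩ G.neighborFinset v) - m := by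
  rw [hardCoreSum_eq_hardCoreSum_sdiff (subset_univ (insert v (G.neighborFinset v)))]
  refine hardCoreSum_nonneg hc fun J hJ => ?_
  have hJv : ∀ x ∈ J, x ≠ v ∧ ¬ G.Adj v x := fun x hx => by
    simpa using (mem_indepSubsets.1 hJ).1 hx
  set U := unblocked G (G.neighborFinset v) J
  have hUv : ∀ u ∈ U, G.Adj v u := fun u hu => by
    simpa using unblocked_subset G _ _ hu
  have hinsert : unblocked G (insert v (G.neighborFinset v)) J = insert v U := by
    ext x
    simp only [mem_unblocked, mem_insert, U]
    grind
  have hcenter : #((J ∪ {v}) ∩ G.neighborFinset v) = 0 := by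
    rw [card_eq_zero, ← disjoint_iff_inter_eq_empty, disjoint_left]
    grind [G.irrefl, SimpleGraph.mem_neighborFinset]
  have htrace : ∀ I ∈ indepSubsets G U, v ∉ J ∪ I ∧ (J ∪ I) ∩ G.neighborFinset v = I := by
    intro I hI
    have hIU := (mem_indepSubsets.1 hI).1
    refine ⟨by grind [G.irrefl], ?_⟩
    ext x
    grind [SimpleGraph.mem_neighborFinset]
  rw [hinsert, hardCoreSum_insert_of_forall_adj hUv, hcenter, if_pos (by simp),
    hardCoreSum_congr (g := fun I => #I - m) fun I hI => by
      rw [if_neg (htrace I hI).1, (htrace I hI).2, zero_add],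
    hardCoreSum_sub, hardCoreSum_const]
  have := hloc U (unblocked_subset G _ _)
  push_cast
  linarith

theorem card_mul_le_mul_indepNum_of_local_occupancy {c a m : ℝ} (hc : 0 < c) (ha : 0 ≤ a)
    (hloc : ∀ v, ∀ U ⊆ G.neighborFinset v,
      m * (c + hardCorePartition G c U) ≤ a * c + hardCoreSum G c U fun I => #I) :
    Fintype.card V * m ≤ (a + G.maxDegree) * G.indepNum := by
  have hsum := sum_nonneg fun v (_ : v ∈ univ) => hardCoreSum_local_occupancy_nonneg hc.le (hloc v)
  rw [← hardCoreSum_sum] at hsum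
  have hbound : ∀ S ∈ indepSubsets G univ,
      ∑ v, ((if v ∈ S then a else 0) + #(S ∩ G.neighborFinset v) - m) ≤
        (a + G.maxDegree) * G.indepNum - Fintype.card V * m := by
    intro S hS
    have hcount : ∑ v, #(S ∩ G.neighborFinset v) = ∑ u ∈ S, G.degree u := by
      have := sum_card_bipartiteAbove_eq_sum_card_bipartiteBelow (s := univ) (t := S) G.Adj
      simpa [bipartiteAbove, bipartiteBelow, ← SimpleGraph.card_neighborFinset_eq_degree,
        SimpleGraph.neighborFinset_eq_filter, inter_filter, G.adj_comm] using this
    have hdeg : ∑ v, (#(S ∩ G.neighborFinset v) : ℝ) ≤ #S * G.maxDegree := by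
      exact_mod_cast hcount.trans_le (sum_le_card_nsmul S _ _ fun u _ => G.degree_le_maxDegree u)
    have hindep : (#S : ℝ) ≤ G.indepNum := by
      exact_mod_cast SimpleGraph.IsIndepSet.card_le_indepNum (mem_filter.1 hS).2
    simp only [sum_sub_distrib, sum_add_distrib, sum_ite_mem, univ_inter, sum_const, card_univ,
      nsmul_eq_mul]
    calc #S * a + ∑ v, (#(S ∩ G.neighborFinset v) : ℝ) - Fintype.card V * m
        ≤ #S * a + #S * G.maxDegree - Fintype.card V * m := by gcongr
      _ = (a + G.maxDegree) * #S - Fintype.card V * m := by ring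
      _ ≤ _ := by gcongr
  have hnonneg := hsum.trans (hardCoreSum_mono hc.le hbound)
  rw [hardCoreSum_const] at hnonneg
  exact sub_nonneg.1 (nonneg_of_mul_nonneg_left hnonneg (hardCorePartition_pos hc))

end LocalOccupancy

theorem card_le_maxDegree_add_one_mul_indepNum {V : Type*} [Fintype V] (G : SimpleGraph V)
    [DecidableRel G.Adj] :
    Fintype.card V ≤ (G.maxDegree + 1) * G.indepNum := by
  classical
  obtain ⟨S, hS⟩ := G.exists_isNIndepSet_indepNum
  have hdominating : univ ⊆ S.biUnion fun v => insert v (G.neighborFinset v) := by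
    intro x _
    by_contra hx
    simp only [mem_biUnion, mem_insert, SimpleGraph.mem_neighborFinset, not_exists, not_and,
      not_or] at hx
    have hxS : x ∉ S := fun h => (hx x h).1 rfl
    have hins : G.IsIndepSet (insert x S : Finset V) := by
      rw [coe_insert, SimpleGraph.IsIndepSet, Set.pairwise_insert]
      exact ⟨hS.isIndepSet, fun y hy _ => ⟨fun h => (hx y hy).2 h.symm, (hx y hy).2⟩⟩
    have := hins.card_le_indepNum
    rw [card_insert_of_notMem hxS, hS.card_eq] at this
    omega
  calc Fintype.card V ≤ ∑ v ∈ S, #(insert v (G.neighborFinset v)) :=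
        (card_le_card hdominating).trans card_biUnion_le
    _ ≤ #S • (G.maxDegree + 1) := sum_le_card_nsmul _ _ _ fun v _ =>
        (card_insert_le _ _).trans (Nat.succ_le_succ (G.degree_le_maxDegree v))
    _ = (G.maxDegree + 1) * G.indepNum := by rw [hS.card_eq, smul_eq_mul, mul_comm]

theorem two_mul_le_two_rpow_half {x : ℝ} (hx : 8 ≤ x) : 2 * x ≤ 2 ^ (x / 2) := by
  have hbernoulli : 1 + (x / 2 - 3) * 1 ≤ (1 + 1 : ℝ) ^ (x / 2 - 3) :=
    one_add_mul_self_le_rpow_one_add (by norm_num) (by linarith)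
  calc 2 * x ≤ 2 ^ (3 : ℝ) * (1 + (x / 2 - 3) * 1) := by norm_num; linarith
    _ ≤ 2 ^ (3 : ℝ) * 2 ^ (x / 2 - 3) := by gcongr; rwa [one_add_one_eq_two] at hbernoulli
    _ = 2 ^ (x / 2) := by rw [← Real.rpow_add two_pos, add_sub_cancel]

/-- Either `U` has an expected occupancy of at least `L / 5`, or it is so small that its partition
function is at most `2 ^ (1 + L / 2)`, which the first term on the right absorbs. -/
theorem local_occupancy_of_card_interedges_le {V : Type*} [DecidableEq V] {G : SimpleGraph V}
    [DecidableRel G.Adj] {c L : ℝ} {U : Finset V} (hc : 0 < c) (hc4 : c ≤ 1 / 4) (hL : 8 ≤ L)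
    (hU : c ^ 2 * #(G.interedges U U) ≤ 3 / 8) :
    L / 5 * (c + hardCorePartition G c U) ≤
      2 ^ L / 4 + hardCoreSum G c U fun I => #I := by
  set Z := hardCorePartition G c U
  set μ := c / (1 + c) with hμ
  have hZ : 0 < Z := hardCorePartition_pos hc
  have hμc : μ * (1 + c) = c := div_mul_cancel₀ c (by positivity)
  have hμ0 : 0 ≤ μ := by positivity
  have hedges : μ ^ 2 * #(G.interedges U U) ≤ 3 / 8 := by
    refine le_trans ?_ hU
    gcongr
    exact div_le_self hc.le (by linarith)
  have hoccupancy : (μ * #U - 3 / 8) * Z ≤ hardCoreSum G c U fun I => #I := by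
    refine le_trans ?_ (le_hardCoreSum_card hc.le)
    gcongr
    linarith
  have hsq : (2 : ℝ) ^ L = (2 ^ (L / 2)) ^ 2 := by
    rw [← Real.rpow_mul_natCast two_pos.le]
    congr 1
    push_cast
    ring
  have hpow := two_mul_le_two_rpow_half hL
  rcases le_or_gt (L / 5) (μ * #U - 3 / 8) with hlarge | hsmall
  · have := mul_le_mul_of_nonneg_right hlarge hZ.le
    nlinarith
  · have hcU : c * #U ≤ Real.log 2 * (1 + L / 2) := by
      calc c * #U = μ * #U * (1 + c) := by linear_combination -(#U : ℝ) * hμc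
        _ ≤ (L / 5 + 3 / 8) * (1 + 1 / 4) := by gcongr; linarith
        _ ≤ 0.6931471803 * (1 + L / 2) := by linarith
        _ ≤ Real.log 2 * (1 + L / 2) := by gcongr; exact Real.log_two_gt_d9.le
    have hZle : Z ≤ 2 * 2 ^ (L / 2) := by
      calc Z ≤ Real.exp (c * #U) := hardCorePartition_le_exp hc.le
        _ ≤ Real.exp (Real.log 2 * (1 + L / 2)) := Real.exp_le_exp.2 hcU
        _ = 2 * 2 ^ (L / 2) := by
          rw [← Real.rpow_def_of_pos two_pos, Real.rpow_add two_pos, Real.rpow_one]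
    have hsize : 0 ≤ hardCoreSum G c U fun I => (#I : ℝ) :=
      hardCoreSum_nonneg hc.le fun I _ => Nat.cast_nonneg _
    calc L / 5 * (c + Z) ≤ L / 5 * (1 / 4 + 2 * 2 ^ (L / 2)) := by gcongr
      _ ≤ 2 ^ L / 4 := by rw [hsq]; nlinarith
      _ ≤ _ := le_add_of_nonneg_right hsize

theorem card_div_mul_logb_le_indepNum {V : Type*} [Fintype V] {G : SimpleGraph V}
    [DecidableRel G.Adj] {t D : ℝ} (ht : 1 ≤ t)
    (hD : G.maxDegree + 1 ≤ D)
    (hsparse : ∀ v, (#(G.interedges (G.neighborFinset v) (G.neighborFinset v)) : ℝ) ≤ 6 * t) :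
    Fintype.card V / D * ((Real.logb 2 D - Real.logb 2 √t) / 10) ≤ G.indepNum := by
  classical
  have hDpos : 0 < D := lt_of_lt_of_le (by positivity) hD
  have hs : 1 ≤ √t := Real.one_le_sqrt.2 ht
  rw [← Real.logb_div hDpos.ne' (by positivity), div_mul_eq_mul_div, div_le_iff₀ hDpos]
  set L := Real.logb 2 (D / √t)
  rcases le_or_gt L 10 with hL | hL
  -- When `L ≤ 10`, the claim is no stronger than the greedy bound.
  · have hgreedy : (Fintype.card V : ℝ) ≤ (G.maxDegree + 1) * G.indepNum := by
      exact_mod_cast card_le_maxDegree_add_one_mul_indepNum G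
    calc Fintype.card V * (L / 10) ≤ Fintype.card V * 1 := by gcongr; linarith
      _ ≤ (G.maxDegree + 1) * G.indepNum := by rwa [mul_one]
      _ ≤ G.indepNum * D := by rw [mul_comm]; gcongr
  -- At fugacity `1 / (4 * √t)` the at most `6 * t` ordered edges of a neighbourhood have total
  -- weight at most `6 / 16`.
  · have hc : 1 / (4 * √t) ≤ 1 / 4 := one_div_le_one_div_of_le (by norm_num) (by linarith)
    have hpow : (2 : ℝ) ^ L = D / √t :=
      Real.rpow_logb two_pos (by norm_num) (by positivity)
    have hlocal := card_mul_le_mul_indepNum_of_local_occupancy (G := G) (c := 1 / (4 * √t))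
      (a := D) (m := L / 5) (by positivity) hDpos.le fun v U hU => by
        rw [show D * (1 / (4 * √t)) = 2 ^ L / 4 by rw [hpow]; field_simp]
        refine local_occupancy_of_card_interedges_le (by positivity) hc (by linarith) ?_
        have hedges : (#(G.interedges U U) : ℝ) ≤ 6 * t :=
          (Nat.cast_le.2 (card_le_card (G.interedges_mono hU hU))).trans (hsparse v)
        calc (1 / (4 * √t)) ^ 2 * (#(G.interedges U U) : ℝ) ≤ (1 / (4 * √t)) ^ 2 * (6 * t) := by
              gcongr
          _ = 3 / 8 := by
              rw [div_pow, mul_pow, Real.sq_sqrt (by linarith)]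
              field_simp
              norm_num
    have hdouble : Fintype.card V * (L / 5) ≤ 2 * D * G.indepNum :=
      hlocal.trans (by gcongr; linarith)
    linarith

section FiberCounts

variable {α : Type*} [Fintype α]

theorem card_filter_card_fiber_eq {ι : Type*} [Fintype ι] [DecidableEq ι] (f : α → ι) (m : ι → ℕ) :
    #{Z : Finset α | ∀ c, #{x ∈ Z | f x = c} = m c} = ∏ c, (#{x | f x = c}).choose (m c) := by
  classical
  simp only [← card_powersetCard, ← Fintype.card_piFinset]
  refine card_bij' (fun Z _ c => {x ∈ Z | f x = c}) (fun B _ => univ.filter fun x => x ∈ B (f x))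
    ?_ ?_ ?_ ?_
  · intro Z hZ
    simp only [mem_filter_univ] at hZ
    simp only [Fintype.mem_piFinset, mem_powersetCard]
    exact fun c => ⟨filter_subset_filter _ (subset_univ Z), hZ c⟩
  · intro B hB
    simp only [Fintype.mem_piFinset, mem_powersetCard, subset_iff, mem_filter_univ] at hB
    simp only [mem_filter_univ]
    intro c
    rw [← (hB c).2]
    congr 1
    grind
  · intro Z _
    ext x
    simp
  · intro B hB
    simp only [Fintype.mem_piFinset, mem_powersetCard, subset_iff, mem_filter_univ] at hB
    funext c
    grind

theorem card_filter_powersetCard (w : ℕ) (P : Finset α → Prop) [DecidablePred P] :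
    #{Y : Set.powersetCard α w | P Y.1} = #{Z : Finset α | #Z = w ∧ P Z} := by
  rw [← card_map (Function.Embedding.subtype _)]
  congr 1
  ext Z
  simp [Set.powersetCard.mem_iff, and_comm]

variable [DecidableEq α]

theorem card_filter_card_inter_eq_card_sdiff_eq (A : Finset α) (a b : ℕ) :
    #{Z | #(Z ∩ A) = a ∧ #(Z \ A) = b} = (#A).choose a * (#Aᶜ).choose b := by
  have key := card_filter_card_fiber_eq (fun x => decide (x ∈ A)) (fun c => cond c a b)
  simp only [Fintype.prod_bool, Bool.forall_bool, decide_eq_true_eq, decide_eq_false_iff_not,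
    filter_mem_eq_inter, filter_notMem_eq_sdiff, univ_inter, cond_true, cond_false,
    ← compl_eq_univ_sdiff] at key
  simpa only [and_comm] using key

theorem card_filter_card_venn_eq (A B : Finset α) (a b c d : ℕ) :
    #{Z | (#(Z ∩ A ∩ B) = a ∧ #((Z ∩ A) \ B) = b) ∧ #((Z \ A) ∩ B) = c ∧ #((Z \ A) \ B) = d} =
      (#(A ∩ B)).choose a * (#(A \ B)).choose b *
        ((#(Aᶜ ∩ B)).choose c * (#(Aᶜ \ B)).choose d) := by
  have key := card_filter_card_fiber_eq (fun x => (decide (x ∈ A), decide (x ∈ B)))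
    (fun p => cond p.1 (cond p.2 a b) (cond p.2 c d))
  simp only [Fintype.prod_prod_type, Prod.forall, Fintype.prod_bool, Bool.forall_bool,
    Prod.mk.injEq, decide_eq_true_eq, decide_eq_false_iff_not, ← filter_filter,
    filter_mem_eq_inter, filter_notMem_eq_sdiff, univ_inter, cond_true, cond_false,
    ← compl_eq_univ_sdiff] at key
  rw [← key]
  congr 1
  grind

end FiberCounts

section JohnsonScheme

variable {α : Type*} [DecidableEq α] {w : ℕ}

/-- The Johnson metric on the `w`-subsets of `α`, half the size of the symmetric difference. -/
def johnsonDist (X Y : Set.powersetCard α w) : ℕ :=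
  #(X.1 \ Y.1)

theorem johnsonDist_comm (X Y : Set.powersetCard α w) : johnsonDist X Y = johnsonDist Y X :=
  card_sdiff_comm (X.2.trans Y.2.symm)

theorem johnsonDist_eq_zero {X Y : Set.powersetCard α w} : johnsonDist X Y = 0 ↔ X = Y := by
  rw [johnsonDist, card_eq_zero, sdiff_eq_empty_iff_subset]
  exact Set.powersetCard.eq_iff_subset.symm

theorem johnsonDist_le (X Y : Set.powersetCard α w) : johnsonDist X Y ≤ w :=
  (card_le_card sdiff_subset).trans_eq X.2

theorem johnsonDist_triangle (X Y Z : Set.powersetCard α w) :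
    johnsonDist X Z ≤ johnsonDist X Y + johnsonDist Y Z := by
  refine (card_le_card ?_).trans (card_union_le _ _)
  grind

/-- The graph on the `w`-subsets of `α` joining distinct sets at Johnson distance at most `r`; its
independent sets are the constant weight codes of minimum distance `2 * (r + 1)`. -/
def johnsonBallGraph (α : Type*) [DecidableEq α] (w r : ℕ) :
    SimpleGraph (Set.powersetCard α w) where
  Adj X Y := johnsonDist X Y ∈ Icc 1 r
  symm := ⟨fun X Y h => johnsonDist_comm X Y ▸ h⟩
  loopless := ⟨fun X h => by simp [johnsonDist_eq_zero.2 (rfl : X = X)] at h⟩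

theorem johnsonBallGraph_adj {r : ℕ} {X Y : Set.powersetCard α w} :
    (johnsonBallGraph α w r).Adj X Y ↔ johnsonDist X Y ∈ Icc 1 r :=
  Iff.rfl

instance (w r : ℕ) : DecidableRel (johnsonBallGraph α w r).Adj :=
  fun X Y => inferInstanceAs (Decidable (johnsonDist X Y ∈ Icc 1 r))

variable [Fintype α]

theorem card_johnsonDist_eq (X : Set.powersetCard α w) (k : ℕ) :
    #{Y | johnsonDist X Y = k} = w.choose k * (Fintype.card α - w).choose k := by
  have hX : #X.1 = w := X.2
  obtain hk | hk := lt_or_ge w k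
  · rw [Nat.choose_eq_zero_of_lt hk, zero_mul, card_eq_zero, filter_eq_empty_iff]
    exact fun Y _ h => (h.symm.trans_le (johnsonDist_le X Y)).not_gt hk
  calc #{Y | johnsonDist X Y = k} = #{Z | #Z = w ∧ #(X.1 \ Z) = k} :=
        card_filter_powersetCard w (fun Z => #(X.1 \ Z) = k)
    _ = #{Z | #(Z ∩ X.1) = w - k ∧ #(Z \ X.1) = k} := by
        congr 1
        ext Z
        have hZ := card_inter_add_card_sdiff Z X.1
        have hXZ := card_inter_add_card_sdiff X.1 Z
        rw [inter_comm] at hXZ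
        simp only [mem_filter_univ]
        omega
    _ = w.choose k * (Fintype.card α - w).choose k := by
        rw [card_filter_card_inter_eq_card_sdiff_eq, card_compl, hX, Nat.choose_symm hk]

theorem card_compl_sdiff (X Y : Set.powersetCard α w) :
    #(X.1ᶜ \ Y.1) = Fintype.card α - w - johnsonDist X Y := by
  have hX : #X.1 = w := X.2
  have hY : #(X.1ᶜ ∩ Y.1) = johnsonDist X Y := by
    rw [inter_comm, ← sdiff_eq_inter_compl]
    exact johnsonDist_comm Y X
  have hsplit := card_inter_add_card_sdiff X.1ᶜ Y.1
  rw [card_compl] at hsplit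
  omega

theorem card_johnsonDist_eq_and_eq_fiber {X Y : Set.powersetCard α w} {i j k l : ℕ}
    (hk : johnsonDist X Y = k) (hli : l ≤ i) (hlj : l ≤ j) (hkl : k + l ≤ i + j)
    (hw : i + j ≤ w + l) :
    #{Z : Finset α | #Z = w ∧ (#(X.1 \ Z) = i ∧ #(Y.1 \ Z) = j) ∧ #((Z \ X.1) \ Y.1) = l} =
      (Fintype.card α - w - k).choose l * k.choose (i - l) * k.choose (j - l) *
        (w - k).choose (i + j - k - l) := by
  have hX : #X.1 = w := X.2
  have hY : #Y.1 = w := Y.2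
  have hXY : #(X.1 \ Y.1) = k := hk
  have hYX : #(X.1ᶜ ∩ Y.1) = k := by
    rw [inter_comm, ← sdiff_eq_inter_compl, ← hk]
    exact johnsonDist_comm Y X
  have hmeet : #(X.1 ∩ Y.1) = w - k := by
    have := card_inter_add_card_sdiff X.1 Y.1
    omega
  have hsymm : w - k - (i + j - k - l) = w + l - i - j := by omega
  rw [← Nat.choose_symm (show i + j - k - l ≤ w - k by omega), hsymm]
  have key := card_filter_card_venn_eq X.1 Y.1 (w + l - i - j) (j - l) (i - l) l
  rw [hXY, hYX, hmeet, card_compl_sdiff, hk] at key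
  rw [show ∀ a b c d : ℕ, a * b * c * d = d * c * (b * a) by intros; ring, ← key]
  congr 1
  ext Z
  have hZ := card_inter_add_card_sdiff Z X.1
  have hZX := card_inter_add_card_sdiff (Z ∩ X.1) Y.1
  have hZX' := card_inter_add_card_sdiff (Z \ X.1) Y.1
  have hZY : #(Z ∩ X.1 ∩ Y.1) + #((Z \ X.1) ∩ Y.1) = #(Y.1 ∩ Z) := by
    rw [← card_inter_add_card_sdiff (Y.1 ∩ Z) X.1]
    congr 2 <;> grind
  have hXZ := card_inter_add_card_sdiff X.1 Z
  have hYZ := card_inter_add_card_sdiff Y.1 Z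
  rw [inter_comm] at hXZ
  simp only [mem_filter_univ]
  omega

theorem card_sdiff_sdiff_mem_Icc (X Y Z : Set.powersetCard α w) :
    #((Z.1 \ X.1) \ Y.1) ∈ Icc
      (max 0 (max (johnsonDist X Z - johnsonDist X Y) (max (johnsonDist Y Z - johnsonDist X Y)
        (johnsonDist X Z + johnsonDist Y Z - w))))
      (min (johnsonDist X Z) (min (johnsonDist Y Z) (min
        (johnsonDist X Z + johnsonDist Y Z - johnsonDist X Y)
        (Fintype.card α - w - johnsonDist X Y)))) := by
  have hZ : #Z.1 = w := Z.2
  have hYX : #(Y.1 \ X.1) = johnsonDist X Y := johnsonDist_comm Y X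
  have hZX : #(Z.1 \ X.1) = johnsonDist X Z := johnsonDist_comm Z X
  have hZY : #(Z.1 \ Y.1) = johnsonDist Y Z := johnsonDist_comm Z Y
  have hmeet : #(X.1 ∩ Y.1) + johnsonDist X Y = w :=
    (card_inter_add_card_sdiff X.1 Y.1).trans X.2
  have hsplit := card_inter_add_card_sdiff Z.1 X.1
  have hsplit_in := card_inter_add_card_sdiff (Z.1 ∩ X.1) Y.1
  have hsplit_out := card_inter_add_card_sdiff (Z.1 \ X.1) Y.1
  have hsplit_Y := card_inter_add_card_sdiff (Z.1 \ Y.1) X.1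
  rw [sdiff_inter_right_comm, sdiff_right_comm] at hsplit_Y
  have h11 : #(Z.1 ∩ X.1 ∩ Y.1) ≤ #(X.1 ∩ Y.1) := card_le_card (by grind)
  have h10 : #((Z.1 ∩ X.1) \ Y.1) ≤ johnsonDist X Y := card_le_card (by grind)
  have h01 : #((Z.1 \ X.1) ∩ Y.1) ≤ #(Y.1 \ X.1) := card_le_card (by grind)
  have h00 : #((Z.1 \ X.1) \ Y.1) ≤ #(X.1ᶜ \ Y.1) :=
    card_le_card (sdiff_subset_sdiff (by grind [mem_compl]) subset_rfl)
  rw [card_compl_sdiff] at h00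
  simp only [mem_Icc, max_le_iff, le_min_iff]
  omega

theorem card_johnsonDist_eq_and_eq (X Y : Set.powersetCard α w) (i j : ℕ) :
    #{Z | johnsonDist X Z = i ∧ johnsonDist Y Z = j} =
      johnsonIntersection (Fintype.card α) w i j (johnsonDist X Y) := by
  set k := johnsonDist X Y with hk
  rw [johnsonIntersection]
  split_ifs with hkij
  · refine (card_eq_sum_card_fiberwise (f := fun Z => #((Z.1 \ X.1) \ Y.1)) ?_).trans
      (sum_congr rfl fun l hl => ?_)
    · intro Z hZ
      obtain ⟨rfl, rfl⟩ := (mem_filter_univ Z).1 hZ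
      exact card_sdiff_sdiff_mem_Icc X Y Z
    simp only [mem_Icc, max_le_iff, le_min_iff] at hl
    rw [filter_filter, ← card_johnsonDist_eq_and_eq_fiber hk.symm (by omega) (by omega) (by omega)
      (by omega), ← card_filter_powersetCard]
    rfl
  · rw [card_eq_zero, filter_eq_empty_iff]
    rintro Z - ⟨rfl, rfl⟩
    exact hkij (johnsonDist_comm Y Z ▸ johnsonDist_triangle X Z Y)

theorem card_johnsonDist_eq_eq_eq (X : Set.powersetCard α w) (i j k : ℕ) :
    #{p : Set.powersetCard α w × Set.powersetCard α w |
        johnsonDist X p.1 = k ∧ johnsonDist X p.2 = i ∧ johnsonDist p.1 p.2 = j} =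
      w.choose k * (Fintype.card α - w).choose k *
        johnsonIntersection (Fintype.card α) w i j k := by
  rw [← card_johnsonDist_eq X k, ← smul_eq_mul, ← sum_const,
    card_eq_sum_card_fiberwise (f := Prod.fst) (t := {Y | johnsonDist X Y = k})]
  · refine sum_congr rfl fun Y hY => ?_
    rw [mem_filter_univ] at hY
    rw [← hY, ← card_johnsonDist_eq_and_eq]
    refine card_bij (fun p _ => p.2) ?_ ?_ ?_
    · grind
    · grind
    · intro Z hZ
      exact ⟨(Y, Z), by grind, rfl⟩
  · intro p hp
    grind

theorem card_johnsonDist_le (r : ℕ) (X : Set.powersetCard α w) :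
    #{Y | johnsonDist X Y ≤ r} = johnsonVolume (Fintype.card α) r w := by
  rw [johnsonVolume, card_eq_sum_card_fiberwise (f := johnsonDist X) (t := range (r + 1))]
  · refine sum_congr rfl fun k hk => ?_
    rw [← card_johnsonDist_eq X k, filter_filter]
    congr 1
    grind
  · intro Y hY
    grind

theorem degree_johnsonBallGraph_add_one (r : ℕ) (X : Set.powersetCard α w) :
    (johnsonBallGraph α w r).degree X + 1 = johnsonVolume (Fintype.card α) r w := by
  rw [← card_johnsonDist_le r X, ← SimpleGraph.card_neighborFinset_eq_degree,
    ← card_insert_of_notMem (SimpleGraph.notMem_neighborFinset_self _ X)]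
  congr 1
  ext Y
  rw [mem_insert, SimpleGraph.mem_neighborFinset, johnsonBallGraph_adj, mem_filter_univ, mem_Icc,
    Nat.one_le_iff_ne_zero, Ne, johnsonDist_eq_zero]
  have hself : X = Y → johnsonDist X Y ≤ r := fun h => (johnsonDist_eq_zero.2 h).trans_le r.zero_le
  grind

theorem maxDegree_johnsonBallGraph_add_one_le (α : Type*) [DecidableEq α] [Fintype α] (w r : ℕ) :
    (johnsonBallGraph α w r).maxDegree + 1 ≤ johnsonVolume (Fintype.card α) r w := by
  have hpos : 0 < johnsonVolume (Fintype.card α) r w :=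
    sum_pos' (fun _ _ => Nat.zero_le _) ⟨0, by simp, by simp⟩
  have hmax : (johnsonBallGraph α w r).maxDegree ≤ johnsonVolume (Fintype.card α) r w - 1 :=
    SimpleGraph.maxDegree_le_of_forall_degree_le _ _ fun X =>
      Nat.le_sub_one_of_lt (degree_johnsonBallGraph_add_one r X).le
  omega

theorem card_interedges_neighborFinset_johnsonBallGraph (r : ℕ) (X : Set.powersetCard α w) :
    (#((johnsonBallGraph α w r).interedges ((johnsonBallGraph α w r).neighborFinset X)
      ((johnsonBallGraph α w r).neighborFinset X)) : ℝ) = 6 * johnsonE (Fintype.card α) r w := by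
  rw [johnsonE, ← mul_assoc, show (6 : ℝ) * (1 / 6) = 1 by norm_num, one_mul]
  norm_cast
  simp only [← card_johnsonDist_eq_eq_eq X, ← sum_product']
  rw [card_eq_sum_card_fiberwise (t := Icc 1 r ×ˢ Icc 1 r ×ˢ Icc 1 r)
    (f := fun p => (johnsonDist X p.2, johnsonDist p.1 p.2, johnsonDist X p.1))]
  · refine sum_congr rfl fun c hc => ?_
    congr 1
    ext p
    simp only [mem_filter, SimpleGraph.mem_interedges_iff, SimpleGraph.mem_neighborFinset,
      johnsonBallGraph_adj]
    grind
  · intro p hp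
    simp only [coe_product, Set.mem_prod, mem_coe, SimpleGraph.mem_interedges_iff,
      SimpleGraph.mem_neighborFinset, johnsonBallGraph_adj] at hp ⊢
    exact ⟨hp.2.1, hp.2.2, hp.1⟩

end JohnsonScheme

theorem johnsonIntersection_one_one_one {n w : ℕ} (hw : 2 ≤ w) (hwn : w + 2 ≤ n) :
    johnsonIntersection n w 1 1 1 = (w - 1) + (n - w - 1) := by
  have hlower : max 0 (max (1 - 1) (max (1 - 1) (1 + 1 - w))) = 0 := by omega
  have hupper : min 1 (min 1 (min (1 + 1 - 1) (n - w - 1))) = 1 := by omega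
  rw [johnsonIntersection, if_pos (by norm_num), hlower, hupper, show Icc 0 1 = {0, 1} from rfl,
    sum_pair zero_ne_one]
  simp

theorem one_le_johnsonE {n w r : ℕ} (hr : 1 ≤ r) (hw : 2 ≤ w) (hwn : w + 2 ≤ n) :
    1 ≤ johnsonE n r w := by
  have hone : 1 ∈ Icc 1 r := mem_Icc.2 ⟨le_rfl, hr⟩
  have hterm : 6 ≤ w.choose 1 * (n - w).choose 1 * johnsonIntersection n w 1 1 1 := by
    rw [johnsonIntersection_one_one_one hw hwn, Nat.choose_one_right, Nat.choose_one_right]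
    calc 6 ≤ 2 * 2 * 2 := by norm_num
      _ ≤ w * (n - w) * (w - 1 + (n - w - 1)) := by gcongr <;> omega
  have hsum : w.choose 1 * (n - w).choose 1 * johnsonIntersection n w 1 1 1 ≤
      ∑ i ∈ Icc 1 r, ∑ j ∈ Icc 1 r, ∑ k ∈ Icc 1 r,
        w.choose k * (n - w).choose k * johnsonIntersection n w i j k := by
    simp only [← sum_product']
    exact single_le_sum_of_canonicallyOrdered
      (f := fun p : ℕ × ℕ × ℕ => w.choose p.2.2 * (n - w).choose p.2.2 *
        johnsonIntersection n w p.1 p.2.1 p.2.2) (i := (1, 1, 1)) (by simp [hone])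
  have hcast : (6 : ℝ) ≤ ∑ i ∈ Icc 1 r, ∑ j ∈ Icc 1 r, ∑ k ∈ Icc 1 r,
      (w.choose k : ℝ) * (n - w).choose k * johnsonIntersection n w i j k := by
    exact_mod_cast hterm.trans hsum
  rw [johnsonE]
  linarith

section Codes

variable {ι : Type*} [DecidableEq ι]

/-- The binary vector with support `X`, used to identify `w`-subsets with vectors of weight `w`. -/
def indicatorVector (X : Finset ι) : ι → ZMod 2 :=
  fun i => if i ∈ X then 1 else 0

theorem indicatorVector_apply_eq_zero {X : Finset ι} {i : ι} :
    indicatorVector X i = 0 ↔ i ∉ X := by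
  simp [indicatorVector]

theorem indicatorVector_injective : Function.Injective (indicatorVector (ι := ι)) := by
  intro X Y h
  ext i
  rw [← not_iff_not, ← indicatorVector_apply_eq_zero, ← indicatorVector_apply_eq_zero, h]

variable [Fintype ι]

theorem indicatorVector_support (x : ι → ZMod 2) :
    indicatorVector {i | x i ≠ 0} = x := by
  have hbit : ∀ a : ZMod 2, (if a ≠ 0 then 1 else 0) = a := by decide
  funext i
  simp only [indicatorVector, mem_filter_univ, hbit]

theorem hammingNorm_indicatorVector (X : Finset ι) : hammingNorm (indicatorVector X) = #X := by
  simp [hammingNorm, indicatorVector]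

theorem hammingDist_indicatorVector (X Y : Finset ι) :
    hammingDist (indicatorVector X) (indicatorVector Y) = #(X \ Y) + #(Y \ X) := by
  rw [← card_union_of_disjoint disjoint_sdiff_sdiff, hammingDist]
  congr 1
  ext i
  rw [mem_filter_univ, mem_union, mem_sdiff, mem_sdiff]
  by_cases hX : i ∈ X <;> by_cases hY : i ∈ Y <;> simp [indicatorVector, hX, hY]

theorem hammingDist_indicatorVector_eq_two_mul_johnsonDist {w : ℕ}
    (X Y : Set.powersetCard ι w) :
    hammingDist (indicatorVector X.1) (indicatorVector Y.1) = 2 * johnsonDist X Y := by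
  rw [hammingDist_indicatorVector, two_mul]
  exact congrArg _ (johnsonDist_comm Y X)

theorem constWeightVectors_eq_image (n w : ℕ) :
    constWeightVectors n w =
      (univ : Finset (Set.powersetCard (Fin n) w)).image fun X => indicatorVector X.1 := by
  ext x
  simp only [constWeightVectors, mem_filter_univ, mem_image, mem_univ, true_and]
  constructor
  · intro hx
    exact ⟨⟨univ.filter fun i => x i ≠ 0, hx⟩, indicatorVector_support x⟩
  · rintro ⟨X, rfl⟩
    exact (hammingNorm_indicatorVector X.1).trans X.2

theorem card_constWeightVectors (n w : ℕ) :
    #(constWeightVectors n w) = Fintype.card (Set.powersetCard (Fin n) w) := by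
  rw [constWeightVectors_eq_image]
  exact card_image_of_injective _ (indicatorVector_injective.comp Subtype.val_injective)

theorem indepNum_johnsonBallGraph_le_maxConstWeightCode (n w r : ℕ) :
    (johnsonBallGraph (Fin n) w r).indepNum ≤ maxConstWeightCode n (2 * (r + 1)) w := by
  obtain ⟨S, hS⟩ := (johnsonBallGraph (Fin n) w r).exists_isNIndepSet_indepNum
  rw [← hS.card_eq, ← card_image_of_injective S
    (indicatorVector_injective.comp Subtype.val_injective)]
  refine le_sup (f := card) ((mem_filter_univ _).2 ⟨?_, ?_⟩)
  · rw [constWeightVectors_eq_image]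
    exact image_subset_image (subset_univ S)
  · simp only [forall_mem_image]
    intro X hX Y hY hne
    have hXY : X ≠ Y := fun h => hne (h ▸ rfl)
    have hpos : johnsonDist X Y ≠ 0 := johnsonDist_eq_zero.not.2 hXY
    have hnonadj : johnsonDist X Y ∉ Icc 1 r := hS.isIndepSet hX hY hXY
    rw [Function.comp, Function.comp, hammingDist_indicatorVector_eq_two_mul_johnsonDist]
    rw [mem_Icc] at hnonadj
    omega

end Codes

theorem mainTheorem7_general (n d w : ℕ) (hd : 2 ≤ d) (hw : 2 ≤ w) (hwn : w + 2 ≤ n) :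
    (maxConstWeightCode n (2 * d) w : ℝ) ≥
      ((constWeightVectors n w).card : ℝ) / (johnsonVolume n (d - 1) w : ℝ) *
        ((Real.logb 2 (johnsonVolume n (d - 1) w : ℝ)
            - Real.logb 2 (Real.sqrt (johnsonE n (d - 1) w))) / 10) := by
  obtain ⟨r, rfl⟩ : ∃ r, d = r + 1 := ⟨d - 1, by omega⟩
  have hdegree := maxDegree_johnsonBallGraph_add_one_le (Fin n) w r
  have hsparse := card_interedges_neighborFinset_johnsonBallGraph (α := Fin n) (w := w) r
  rw [Fintype.card_fin] at hdegree hsparse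
  rw [Nat.add_sub_cancel, card_constWeightVectors]
  calc _ ≤ ((johnsonBallGraph (Fin n) w r).indepNum : ℝ) :=
        card_div_mul_logb_le_indepNum (one_le_johnsonE (by omega) hw hwn)
          (by exact_mod_cast hdegree) fun X => (hsparse X).le
    _ ≤ maxConstWeightCode n (2 * (r + 1)) w := by
        exact_mod_cast indepNum_johnsonBallGraph_le_maxConstWeightCode n w r

theorem mainTheorem7 (n d w : ℕ) (hd : 2 ≤ d) (hdw : d ≤ w) (hwn : 2 * w ≤ n) :
    (maxConstWeightCode n (2 * d) w : ℝ) ≥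
      ((constWeightVectors n w).card : ℝ) / (johnsonVolume n (d - 1) w : ℝ) *
        ((Real.logb 2 (johnsonVolume n (d - 1) w : ℝ)
            - Real.logb 2 (Real.sqrt (johnsonE n (d - 1) w))) / 10) :=
  mainTheorem7_general n d w hd (by omega) (by omega)
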